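/- Let $H$ be a complex separable Hilbert space with an orthogonal splitting $H=H_1\oplus H_2$ into closed subspaces, let $P_1,P_2$ be the orthogonal projections of $H$ onto $H_1,H_2$, and let $J=P_1-P_2$. For a bounded linear operator $A$ on $H$ put $$A_{\mathrm{even}}=P_1AP_1+P_2AP_2,\qquad A_{\mathrm{odd}}=P_1AP_2+P_2AP_1,\qquad \widehat A=AP_1+(1-A)P_2,$$ and for $i=1,2$ let $A_{ii}:H_i\to H_i$ be the diagonal block of $A$, i.e. the restriction of $P_iA$ to $H_i$. Let $\mathscr L_{1|2}(H)$ be the set of bounded linear operators $A$ on $H$ such that $A_{\mathrm{even}}$ is trace-class and $A_{\mathrm{odd}}$ is Hilbert--Schmidt. Call $A$ $J$-self-adjoint if $[Af,g]=[f,Ag]$ for all $f,g\in H$, where $[f,g]=(Jf,g)$. Let $A\in\mathscr L_{1|2}(H)$ be $J$-self-adjoint, with $0\le\widehat A\le 1$ in the sense of self-adjoint operators and $\|A\|<1$. Then $1-A$ is invertible, and the operator $L:=A(1-A)^{-1}$ is $J$-self-adjoint and belongs to $\mathscr L_{1|2}(H)$, and its diagonal blocks satisfy $L_{11}\ge 0$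 and $L_{22}\ge 0$. -/

import Mathlib

noncomputable section

namespace JOperator

variable {H : Type*} [NormedAddCommGroup H] [InnerProductSpace ℂ H]

section Ideals

variable [CompleteSpace H]

/-- `A` is trace-class: `Tr |A| < ∞` with `|A| = (A* A)^{1/2}`, the trace of the nonnegative
operator `|A|` being the sum of the nonnegative terms `(|A| e_i, e_i)` over an orthonormal basis.
(The sum does not depend on the basis; orthonormal bases are indexed by subsets of `H`.) -/
def IsTraceClass (A : H →L[ℂ] H) : Prop :=
  ∀ (w : Set H) (e : HilbertBasis w ℂ H),
    Summable fun i : w => RCLike.re (inner ℂ (CFC.abs A (e i)) (e i))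

/-- `A` is Hilbert-Schmidt: `∑ ‖A e_i‖² < ∞` over an orthonormal basis.
(The sum does not depend on the basis.) -/
def IsHilbertSchmidt (A : H →L[ℂ] H) : Prop :=
  ∀ (w : Set H) (e : HilbertBasis w ℂ H), Summable fun i : w => ‖A (e i)‖ ^ 2

end Ideals

/-! The splitting is `H = H₁ ⊕ H₁ᗮ`, with `H₁` a closed subspace and `H₂ = H₁ᗮ`. -/

variable (H₁ : Submodule ℂ H) [H₁.HasOrthogonalProjection]

/-- The orthogonal projection of `H` onto `H₁`. -/
def P₁ : H →L[ℂ] H := H₁.starProjection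

/-- The orthogonal projection of `H` onto `H₂ = H₁ᗮ`. -/
def P₂ : H →L[ℂ] H := H₁ᗮ.starProjection

/-- The even (block diagonal) part of `A`. -/
def evenPart (A : H →L[ℂ] H) : H →L[ℂ] H := P₁ H₁ * A * P₁ H₁ + P₂ H₁ * A * P₂ H₁

/-- The odd (block off-diagonal) part of `A`. -/
def oddPart (A : H →L[ℂ] H) : H →L[ℂ] H := P₁ H₁ * A * P₂ H₁ + P₂ H₁ * A * P₁ H₁

/-- The block `A₁₁ : H₁ → H₁`. -/
def block₁₁ (A : H →L[ℂ] H) : H₁ →L[ℂ] H₁ :=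
  H₁.orthogonalProjectionOnto ∘L A ∘L H₁.subtypeL

/-- The block `A₂₂ : H₂ → H₂`. -/
def block₂₂ (A : H →L[ℂ] H) : H₁ᗮ →L[ℂ] H₁ᗮ :=
  H₁ᗮ.orthogonalProjectionOnto ∘L A ∘L H₁ᗮ.subtypeL

/-- The operators whose even part is trace-class and whose odd part is Hilbert-Schmidt. -/
def L12 [CompleteSpace H] : Set (H →L[ℂ] H) :=
  {A | IsTraceClass (evenPart H₁ A) ∧ IsHilbertSchmidt (oddPart H₁ A)}

/-- `J = P₁ - P₂`. -/
def J : H →L[ℂ] H := P₁ H₁ - P₂ H₁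

/-- The indefinite scalar product `[f, g] = (J f, g)`. -/
def jInner (f g : H) : ℂ := inner ℂ (J H₁ f) g

/-- `A` is `J`-self-adjoint. -/
def IsJSelfAdjoint (A : H →L[ℂ] H) : Prop :=
  ∀ f g : H, jInner H₁ (A f) g = jInner H₁ f (A g)

/-- The transform `Â = A P₁ + (1 - A) P₂`. -/
def hat (A : H →L[ℂ] H) : H →L[ℂ] H := A * P₁ H₁ + (1 - A) * P₂ H₁

end JOperator

end

open ContinuousLinearMap
open scoped ComplexOrder

/-! Trace-class membership comes from `L = A + A * L`. Trace-class operators are Hilbert-Schmidt, so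
`A` and `L = A * (1 - A)⁻¹` are Hilbert-Schmidt and `A * L` is trace-class. Sums and products are
handled by testing `T` against contractions (`isTraceClass_iff`).

For positivity, let `K` be the hat transform of `A`, `f` in `H₁` or `H₁ᗮ`, `g = (1 - A)⁻¹ f` and `h
= J g`. Since `0 ≤ K ≤ 1`, `(K h, h - K h) ≥ 0`. Orthogonality of the blocks identifies this number,
up to conjugation, with `(A g, g - A g) = (L f, f)`. -/

namespace JOperator

/-! ### Hilbert-Schmidt operators -/

section HilbertSchmidt

variable {H : Type*} [NormedAddCommGroup H] [InnerProductSpace ℂ H]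

/-- Parseval's identity. -/
theorem hasSum_norm_inner_sq {ι : Type*} (e : HilbertBasis ι ℂ H) (x : H) :
    HasSum (fun i => ‖(inner ℂ (e i) x : ℂ)‖ ^ 2) (‖x‖ ^ 2) := by
  have h := RCLike.hasSum_re ℂ (e.hasSum_inner_mul_inner x x)
  rw [inner_self_eq_norm_sq] at h
  convert! h using 2 with i
  rw [← inner_conj_symm x (e i), RCLike.conj_mul]
  norm_cast

theorem norm_sq_apply_le (B : H →L[ℂ] H) (x : H) : ‖B x‖ ^ 2 ≤ ‖B‖ ^ 2 * ‖x‖ ^ 2 := by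
  rw [← mul_pow]
  exact pow_le_pow_left₀ (norm_nonneg _) (B.le_opNorm x) 2

/-- The cross term `2 ε Re (S y, y)` is nonnegative. This makes `S (S + ε)⁻¹` a contraction. -/
theorem norm_apply_le_norm_apply_add_smul {S : H →L[ℂ] H} (hS : 0 ≤ S) {ε : ℝ} (hε : 0 ≤ ε)
    (y : H) : ‖S y‖ ≤ ‖S y + (ε : ℂ) • y‖ := by
  refine pow_le_pow_iff_left₀ (norm_nonneg _) (norm_nonneg _) two_ne_zero |>.1 ?_
  rw [norm_add_sq (𝕜 := ℂ), inner_smul_right]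
  have h := ((nonneg_iff_isPositive S).1 hS).re_inner_nonneg_left y
  have h2 : RCLike.re ((ε : ℂ) * (inner ℂ (S y) y : ℂ)) = ε * RCLike.re (inner ℂ (S y) y : ℂ) := by
    simp
  rw [h2]
  have := mul_nonneg hε h
  nlinarith [sq_nonneg ‖(ε : ℂ) • y‖]

theorem sum_re_inner_apply_le_of_norm_sub_le {ι : Type*} (e : HilbertBasis ι ℂ H)
    {T T' W : H →L[ℂ] H} {ε : ℝ} (h : ‖T - T'‖ ≤ ε) (hW : ‖W‖ ≤ 1) (F : Finset ι) :
    ∑ i ∈ F, RCLike.re (inner ℂ (T (e i)) (W (e i)) : ℂ) ≤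
      ∑ i ∈ F, RCLike.re (inner ℂ (T' (e i)) (W (e i)) : ℂ) + F.card * ε := by
  rw [← nsmul_eq_mul, ← Finset.sum_const, ← Finset.sum_add_distrib]
  refine Finset.sum_le_sum fun i _ => ?_
  have he : ‖e i‖ = 1 := e.orthonormal.1 i
  have h1 : ‖(T - T') (e i)‖ ≤ ε := by simpa [he] using (T - T').le_of_opNorm_le h (e i)
  have h2 : ‖W (e i)‖ ≤ 1 := by simpa [he] using W.le_of_opNorm_le hW (e i)
  have h3 := re_inner_le_norm (𝕜 := ℂ) ((T - T') (e i)) (W (e i))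
  have h4 : ‖(T - T') (e i)‖ * ‖W (e i)‖ ≤ ε := by
    calc _ ≤ ‖(T - T') (e i)‖ * 1 := by gcongr
      _ ≤ ε := by rwa [mul_one]
  rw [sub_apply, inner_sub_left, map_sub] at h3
  rw [sub_apply] at h4
  linarith

theorem le_of_forall_le_add_natCast_mul {a b : ℝ} (n : ℕ) (h : ∀ ε : ℝ, 0 < ε → a ≤ b + n * ε) :
    a ≤ b := by
  refine le_of_forall_pos_le_add fun ε hε => (h (ε / (n + 1)) (by positivity)).trans ?_
  gcongr
  rw [mul_div_assoc', div_le_iff₀ (by positivity)]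
  nlinarith

theorem summable_iff_tsum_ofReal_ne_top {ι : Type*} {f : ι → ℝ} (hf : ∀ i, 0 ≤ f i) :
    Summable f ↔ ∑' i, ENNReal.ofReal (f i) ≠ ⊤ := by
  refine ⟨fun h => h.tsum_ofReal_ne_top, fun h => ?_⟩
  have := ENNReal.summable_toReal h
  simpa [ENNReal.toReal_ofReal, hf] using this

theorem ofReal_norm_sq_eq_tsum {ι : Type*} (e : HilbertBasis ι ℂ H) (x : H) :
    ENNReal.ofReal (‖x‖ ^ 2) = ∑' i, ENNReal.ofReal (‖(inner ℂ (e i) x : ℂ)‖ ^ 2) := by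
  have h := hasSum_norm_inner_sq e x
  rw [← h.tsum_eq, ENNReal.ofReal_tsum_of_nonneg (fun _ => by positivity) h.summable]

theorem IsHilbertSchmidt.mul_left {X : H →L[ℂ] H} (hX : IsHilbertSchmidt X) (B : H →L[ℂ] H) :
    IsHilbertSchmidt (B * X) := fun w e =>
  Summable.of_nonneg_of_le (fun _ => by positivity) (fun i => norm_sq_apply_le B (X (e i)))
    ((hX w e).mul_left (‖B‖ ^ 2))

theorem IsHilbertSchmidt.add {X Y : H →L[ℂ] H} (hX : IsHilbertSchmidt X)
    (hY : IsHilbertSchmidt Y) : IsHilbertSchmidt (X + Y) := fun w e => by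
  refine Summable.of_nonneg_of_le (fun _ => by positivity) (fun i => ?_)
    (((hX w e).add (hY w e)).mul_left 2)
  have h := norm_add_le (X (e i)) (Y (e i))
  have h' := pow_le_pow_left₀ (norm_nonneg _) h 2
  rw [add_apply]
  nlinarith [sq_nonneg (‖X (e i)‖ - ‖Y (e i)‖)]

variable [CompleteSpace H]

/-- By Parseval both sides sum the squared matrix entries of `X`; working in `ENNReal` allows the
swap before summability is known. -/
theorem tsum_ofReal_norm_sq_adjoint {ι : Type*} (e : HilbertBasis ι ℂ H) (X : H →L[ℂ] H) :
    ∑' i, ENNReal.ofReal (‖(star X) (e i)‖ ^ 2) = ∑' i, ENNReal.ofReal (‖X (e i)‖ ^ 2) := by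
  simp_rw [ofReal_norm_sq_eq_tsum e]
  rw [ENNReal.tsum_comm]
  refine tsum_congr fun i => tsum_congr fun j => ?_
  rw [star_eq_adjoint, adjoint_inner_right, ← inner_conj_symm, RCLike.norm_conj]

theorem IsHilbertSchmidt.star {X : H →L[ℂ] H} (hX : IsHilbertSchmidt X) :
    IsHilbertSchmidt (star X) := by
  intro w e
  have h := hX w e
  rw [summable_iff_tsum_ofReal_ne_top fun _ => by positivity] at h ⊢
  rwa [tsum_ofReal_norm_sq_adjoint]

theorem IsHilbertSchmidt.mul_right {X : H →L[ℂ] H} (hX : IsHilbertSchmidt X) (B : H →L[ℂ] H) :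
    IsHilbertSchmidt (X * B) := by
  simpa using (hX.star.mul_left (Star.star B)).star

theorem tsum_norm_sq_adjoint_mul_le {ι : Type*} (e : HilbertBasis ι ℂ H) (X W : H →L[ℂ] H)
    (hX : Summable fun i => ‖X (e i)‖ ^ 2) (hW : ‖W‖ ≤ 1) (F : Finset ι) :
    ∑ i ∈ F, ‖(star X * W) (e i)‖ ^ 2 ≤ ∑' i, ‖X (e i)‖ ^ 2 := by
  have hle : ∑' i, ENNReal.ofReal (‖(star X * W) (e i)‖ ^ 2) ≤
      ∑' i, ENNReal.ofReal (‖X (e i)‖ ^ 2) := by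
    -- `X* W` is the adjoint of `W* X`, where the contraction acts last and is bounded termwise.
    have := tsum_ofReal_norm_sq_adjoint e (star W * X)
    rw [star_mul, star_star] at this
    rw [this]
    refine ENNReal.tsum_le_tsum fun i => ENNReal.ofReal_le_ofReal ?_
    refine (norm_sq_apply_le (star W) (X (e i))).trans ?_
    rw [norm_star]
    exact mul_le_of_le_one_left (by positivity) (pow_le_one₀ (norm_nonneg _) hW)
  rw [← ENNReal.ofReal_tsum_of_nonneg (fun _ => by positivity) hX] at hle
  rw [← ENNReal.ofReal_le_ofReal_iff (tsum_nonneg fun _ => by positivity),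
    ENNReal.ofReal_sum_of_nonneg fun _ _ => by positivity]
  exact (ENNReal.sum_le_tsum F).trans hle

/-- The finite partial sums of `Re Tr (W* X Y)` are bounded uniformly over contractions `W`. -/
theorem sum_re_inner_mul_le {ι : Type*} (e : HilbertBasis ι ℂ H) (X Y W : H →L[ℂ] H)
    (hX : Summable fun i => ‖X (e i)‖ ^ 2) (hY : Summable fun i => ‖Y (e i)‖ ^ 2)
    (hW : ‖W‖ ≤ 1) (F : Finset ι) :
    ∑ i ∈ F, RCLike.re (inner ℂ ((X * Y) (e i)) (W (e i)) : ℂ) ≤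
      ∑' i, ‖Y (e i)‖ ^ 2 + ∑' i, ‖X (e i)‖ ^ 2 := by
  refine le_trans (Finset.sum_le_sum (g := fun i => ‖Y (e i)‖ ^ 2 + ‖(star X * W) (e i)‖ ^ 2)
    fun i _ => ?_) ?_
  · have h : (inner ℂ ((X * Y) (e i)) (W (e i)) : ℂ) = inner ℂ (Y (e i)) ((star X * W) (e i)) := by
      simp [star_eq_adjoint, adjoint_inner_right]
    rw [h]
    have := re_inner_le_norm (𝕜 := ℂ) (Y (e i)) ((star X * W) (e i))
    nlinarith [sq_nonneg (‖Y (e i)‖ - ‖(star X * W) (e i)‖), sq_nonneg ‖Y (e i)‖,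
      sq_nonneg ‖(star X * W) (e i)‖]
  · rw [Finset.sum_add_distrib]
    exact add_le_add (hY.sum_le_tsum F fun _ _ => by positivity)
      (tsum_norm_sq_adjoint_mul_le e X W hX hW F)

end HilbertSchmidt

/-! ### Trace-class operators -/

section TraceClass

variable {H : Type*} [NormedAddCommGroup H] [InnerProductSpace ℂ H] [CompleteSpace H]

theorem norm_apply_eq_norm_abs_apply (T : H →L[ℂ] H) (x : H) : ‖T x‖ = ‖CFC.abs T x‖ := by
  have hS : star (CFC.abs T) = CFC.abs T := (IsSelfAdjoint.of_nonneg (CFC.abs_nonneg T)).star_eq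
  have h (A : H →L[ℂ] H) : ‖A x‖ ^ 2 = RCLike.re (inner ℂ ((star A * A) x) x : ℂ) := by
    rw [star_eq_adjoint, mul_apply_eq_comp, adjoint_inner_left, inner_self_eq_norm_sq]
  refine (pow_left_inj₀ (norm_nonneg _) (norm_nonneg _) two_ne_zero).1 ?_
  rw [h, h, hS, CFC.abs_mul_abs]

/-- An approximate polar decomposition by the contraction `T (|T| + ε)⁻¹`. -/
theorem exists_approx_polar (T : H →L[ℂ] H) {ε : ℝ} (hε : 0 < ε) :
    ∃ V : H →L[ℂ] H, ‖V‖ ≤ 1 ∧ ‖T - V * CFC.abs T‖ ≤ ε ∧ ‖CFC.abs T - star V * T‖ ≤ ε := by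
  set S := CFC.abs T with hSdef
  have hS : 0 ≤ S := CFC.abs_nonneg T
  have hSsa : star S = S := (IsSelfAdjoint.of_nonneg hS).star_eq
  have hSS : S * S = star T * T := CFC.abs_mul_abs T
  have hTS := norm_apply_eq_norm_abs_apply T
  set M : H →L[ℂ] H := S + (ε : ℂ) • 1 with hM
  have hMu : IsUnit M := by
    refine CStarAlgebra.isUnit_of_le ((ε : ℂ) • (1 : H →L[ℂ] H)) (le_add_of_nonneg_left hS) ?_
    refine IsUnit.isStrictlyPositive ?_ ?_
    · exact isUnit_one.smul (Units.mk0 (ε : ℂ) (by exact_mod_cast hε.ne'))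
    · exact smul_nonneg (by exact_mod_cast hε.le) zero_le_one
  obtain ⟨u, hu⟩ := hMu
  set N : H →L[ℂ] H := ↑u⁻¹ with hN
  have hMN : M * N = 1 := by rw [← hu]; simp [hN]
  have hNM : N * M = 1 := by rw [← hu]; simp [hN]
  have hMsa : star M = M := by simp [hM, hSsa]
  have hNsa : star N = N := by
    have : star N * M = 1 := by rw [← hMsa, ← star_mul, hMN, star_one]
    exact left_inv_eq_right_inv this hMN
  have hSN : ‖S * N‖ ≤ 1 := by
    refine opNorm_le_bound _ zero_le_one fun x => ?_
    rw [one_mul, mul_apply_eq_comp]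
    refine (norm_apply_le_norm_apply_add_smul hS hε.le (N x)).trans (le_of_eq ?_)
    have hx : M (N x) = x := by rw [← mul_apply_eq_comp, hMN, one_apply_eq_self]
    conv_rhs => rw [← hx]
    simp [hM]
  have hTN : ‖T * N‖ ≤ 1 := by
    refine opNorm_le_bound _ zero_le_one fun x => ?_
    rw [mul_apply_eq_comp, hTS]
    exact (S * N).le_of_opNorm_le hSN x
  have hNS : ‖N * S‖ ≤ 1 := by
    rw [← norm_star, star_mul, hNsa, hSsa]; exact hSN
  have hNS' : 1 - N * S = (ε : ℂ) • N := by
    rw [← hNM, hM]; simp [mul_add]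
  have hεn : ‖(ε : ℂ)‖ = ε := by simp [hε.le]
  refine ⟨T * N, hTN, ?_, ?_⟩
  -- Both errors are `ε` times a contraction, because `1 - N S = ε N`.
  · have : T - T * N * S = (ε : ℂ) • (T * N) := by
      rw [← mul_smul_comm, ← hNS', mul_sub, mul_one, mul_assoc]
    rw [this, norm_smul, hεn]
    exact mul_le_of_le_one_right hε.le hTN
  · have : S - star (T * N) * T = (ε : ℂ) • (N * S) := by
      rw [star_mul, hNsa, mul_assoc, ← hSS, ← smul_mul_assoc, ← hNS', sub_mul, one_mul, mul_assoc]
    rw [this, norm_smul, hεn]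
    exact mul_le_of_le_one_right hε.le hNS

theorem norm_sqrt_abs_apply_sq (T : H →L[ℂ] H) (x : H) :
    ‖CFC.sqrt (CFC.abs T) x‖ ^ 2 = RCLike.re (inner ℂ (CFC.abs T x) x : ℂ) := by
  have hR : star (CFC.sqrt (CFC.abs T)) = CFC.sqrt (CFC.abs T) :=
    (IsSelfAdjoint.of_nonneg (CFC.sqrt_nonneg _)).star_eq
  have h := CFC.sqrt_mul_sqrt_self (CFC.abs T) (CFC.abs_nonneg T)
  conv_rhs => rw [← h, mul_apply_eq_comp, ← hR, star_eq_adjoint, adjoint_inner_left,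
    ← star_eq_adjoint, hR]
  rw [inner_self_eq_norm_sq]

/-- A variational characterization of the trace class. -/
theorem isTraceClass_iff {T : H →L[ℂ] H} :
    IsTraceClass T ↔ ∀ (w : Set H) (e : HilbertBasis w ℂ H), ∃ C : ℝ, ∀ W : H →L[ℂ] H, ‖W‖ ≤ 1 →
      ∀ F : Finset w, ∑ i ∈ F, RCLike.re (inner ℂ (T (e i)) (W (e i)) : ℂ) ≤ C := by
  refine ⟨fun hT w e => ?_, fun hT w e => ?_⟩
  -- `T` is close to `V R R` with `R` Hilbert-Schmidt. The error on `F` is at most `F.card * ε`, and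
  -- the bound is independent of `ε`.
  · set R := CFC.sqrt (CFC.abs T) with hR
    have hRR : R * R = CFC.abs T := CFC.sqrt_mul_sqrt_self _ (CFC.abs_nonneg T)
    have hs : Summable fun i => ‖R (e i)‖ ^ 2 := by
      simpa only [hR, norm_sqrt_abs_apply_sq] using hT w e
    refine ⟨∑' i, ‖R (e i)‖ ^ 2 + ∑' i, ‖R (e i)‖ ^ 2, fun W hW F => ?_⟩
    refine le_of_forall_le_add_natCast_mul F.card fun ε hε => ?_
    obtain ⟨V, hV, hVT, -⟩ := exists_approx_polar T hε
    refine (sum_re_inner_apply_le_of_norm_sub_le e hVT hW F).trans ?_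
    gcongr
    have hVW : ‖star V * W‖ ≤ 1 := by
      refine (norm_mul_le _ _).trans ?_
      rw [norm_star]
      exact mul_le_one₀ hV (norm_nonneg _) hW
    refine le_trans (le_of_eq ?_) (sum_re_inner_mul_le e R R (star V * W) hs hs hVW F)
    refine Finset.sum_congr rfl fun i _ => ?_
    rw [hRR, mul_apply_eq_comp, mul_apply_eq_comp, star_eq_adjoint, adjoint_inner_right]
  -- Conversely, the test contraction `W = V` nearly recovers `|T|`, since `V* T` is close to it.
  · obtain ⟨C, hC⟩ := hT w e
    refine summable_of_sum_le (c := C) (fun i => ?_) fun F => ?_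
    · exact ((nonneg_iff_isPositive _).1 (CFC.abs_nonneg T)).re_inner_nonneg_left _
    · refine le_of_forall_le_add_natCast_mul F.card fun ε hε => ?_
      obtain ⟨V, hV, -, hVT⟩ := exists_approx_polar T hε
      refine (sum_re_inner_apply_le_of_norm_sub_le e (W := 1) hVT norm_id_le F).trans ?_
      gcongr
      refine le_trans (le_of_eq ?_) (hC V hV F)
      refine Finset.sum_congr rfl fun i _ => ?_
      rw [mul_apply_eq_comp, star_eq_adjoint, adjoint_inner_left, one_apply_eq_self]

theorem IsTraceClass.add {S T : H →L[ℂ] H} (hS : IsTraceClass S) (hT : IsTraceClass T) :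
    IsTraceClass (S + T) := by
  rw [isTraceClass_iff] at *
  intro w e
  obtain ⟨C, hC⟩ := hS w e
  obtain ⟨D, hD⟩ := hT w e
  refine ⟨C + D, fun W hW F => ?_⟩
  simpa [inner_add_left, Finset.sum_add_distrib] using add_le_add (hC W hW F) (hD W hW F)

theorem IsHilbertSchmidt.mul {X Y : H →L[ℂ] H} (hX : IsHilbertSchmidt X)
    (hY : IsHilbertSchmidt Y) : IsTraceClass (X * Y) :=
  isTraceClass_iff.2 fun w e =>
    ⟨_, fun W hW F => sum_re_inner_mul_le e X Y W (hX w e) (hY w e) hW F⟩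

theorem IsTraceClass.isHilbertSchmidt {T : H →L[ℂ] H} (hT : IsTraceClass T) :
    IsHilbertSchmidt T := by
  have hR : IsHilbertSchmidt (CFC.sqrt (CFC.abs T)) := fun w e => by
    simpa only [norm_sqrt_abs_apply_sq] using hT w e
  have hA : IsHilbertSchmidt (CFC.abs T) := by
    rw [← CFC.sqrt_mul_sqrt_self (CFC.abs T) (CFC.abs_nonneg T)]
    exact hR.mul_left _
  intro w e
  simpa only [norm_apply_eq_norm_abs_apply T] using hA w e

end TraceClass

/-! ### Block structure, `J`-symmetry and positivity -/

section Blocks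

variable {H : Type*} [NormedAddCommGroup H] [InnerProductSpace ℂ H]
  (H₁ : Submodule ℂ H) [H₁.HasOrthogonalProjection]

theorem P₁_add_P₂ : P₁ H₁ + P₂ H₁ = 1 := by
  ext x
  simp [P₁, P₂]

theorem evenPart_add_oddPart (A : H →L[ℂ] H) : evenPart H₁ A + oddPart H₁ A = A := by
  have h : (P₁ H₁ + P₂ H₁) * A * (P₁ H₁ + P₂ H₁) = A := by rw [P₁_add_P₂]; simp
  conv_rhs => rw [← h]
  simp only [evenPart, oddPart, mul_add, add_mul]
  abel

theorem mem_L12_of_eq_add_mul [CompleteSpace H] {A L : H →L[ℂ] H} (hA : A ∈ L12 H₁)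
    {B : H →L[ℂ] H} (hL : L = A * B) (hL' : L = A + A * L) : L ∈ L12 H₁ := by
  have hAhs : IsHilbertSchmidt A := by
    rw [← evenPart_add_oddPart H₁ A]
    exact hA.1.isHilbertSchmidt.add hA.2
  have hLhs : IsHilbertSchmidt L := hL ▸ hAhs.mul_right B
  refine ⟨?_, ?_⟩
  · have h : evenPart H₁ L = evenPart H₁ A +
        (P₁ H₁ * A * (L * P₁ H₁) + P₂ H₁ * A * (L * P₂ H₁)) := by
      conv_lhs => rw [hL']
      simp only [evenPart, mul_add, add_mul, mul_assoc]
      abel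
    rw [h]
    exact hA.1.add (((hAhs.mul_left _).mul (hLhs.mul_right _)).add
      ((hAhs.mul_left _).mul (hLhs.mul_right _)))
  · exact ((hLhs.mul_left _).mul_right _).add ((hLhs.mul_left _).mul_right _)

/-- With `u = B f` and `v = B g`, the claim is `[A u, v - A v] = [u - A u, A v]`; the term `[A u, A
v]` is common. -/
theorem IsJSelfAdjoint.of_mul_one_sub {A L B : H →L[ℂ] H} (hJ : IsJSelfAdjoint H₁ A)
    (hB : (1 - A) * B = 1) (hL : L = A * B) : IsJSelfAdjoint H₁ L := by
  intro f g
  have hf : f = B f - A (B f) := by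
    simpa using (congrArg (fun T : H →L[ℂ] H => T f) hB).symm
  have hg : g = B g - A (B g) := by
    simpa using (congrArg (fun T : H →L[ℂ] H => T g) hB).symm
  have h := hJ (B f) (B g)
  rw [hL, mul_apply_eq_comp, mul_apply_eq_comp]
  conv_lhs => rw [hg]
  conv_rhs => rw [hf]
  simp only [jInner, map_sub, inner_sub_left, inner_sub_right] at h ⊢
  rw [h]

variable {H₁} in
theorem hat_apply (A : H →L[ℂ] H) (g : H) :
    hat H₁ A (J H₁ g) = A g - P₂ H₁ g := by
  have h : H₁.starProjection (H₁.starProjection g) = H₁.starProjection g :=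
    Submodule.starProjection_eq_self_iff.2 (Submodule.starProjection_apply_mem _ _)
  simp only [hat, J, P₁, P₂, Submodule.starProjection_orthogonal_val, add_apply, sub_apply,
    mul_apply_eq_comp, one_apply_eq_self, map_sub, h]
  abel

/-- `K` and `1 - K` are commuting nonnegative operators, so `K (1 - K) ≥ 0`. -/
theorem inner_apply_sub_nonneg [CompleteSpace H] {K : H →L[ℂ] H} (h0 : 0 ≤ K) (h1 : K ≤ 1)
    (h : H) : 0 ≤ (inner ℂ (K h) (h - K h) : ℂ) := by
  have hK : star K = K := (IsSelfAdjoint.of_nonneg h0).star_eq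
  have hc : Commute K (1 - K) := (Commute.one_right K).sub_right (Commute.refl K)
  have := ((nonneg_iff_isPositive _).1 (hc.mul_nonneg h0 (sub_nonneg.2 h1))).inner_nonneg_right h
  rw [mul_apply_eq_comp, ← adjoint_inner_left, ← star_eq_adjoint, hK] at this
  rwa [sub_apply, one_apply_eq_self] at this

theorem inner_P₁_P₂ (x y : H) : (inner ℂ (P₁ H₁ x) (P₂ H₁ y) : ℂ) = 0 :=
  Submodule.inner_right_of_mem_orthogonal (Submodule.starProjection_apply_mem H₁ x)
    (Submodule.starProjection_apply_mem H₁ᗮ y)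

theorem inner_P₂_P₁ (x y : H) : (inner ℂ (P₂ H₁ x) (P₁ H₁ y) : ℂ) = 0 :=
  Submodule.inner_left_of_mem_orthogonal (Submodule.starProjection_apply_mem H₁ y)
    (Submodule.starProjection_apply_mem H₁ᗮ x)

theorem P₁_apply_add_P₂_apply (x : H) : P₁ H₁ x + P₂ H₁ x = x := by
  rw [← add_apply, P₁_add_P₂, one_apply_eq_self]

theorem P₁_apply_eq_zero {x : H} (hx : x ∈ H₁ᗮ) : P₁ H₁ x = 0 :=
  (Submodule.starProjection_apply_eq_zero_iff _).2 hx

theorem P₂_apply_eq_zero {x : H} (hx : x ∈ H₁) : P₂ H₁ x = 0 :=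
  (Submodule.starProjection_apply_eq_zero_iff _).2 (H₁.le_orthogonal_orthogonal hx)

variable {H₁}

/-- Here `P₂ g = P₂ A g`, so `K J g = P₁ A g` lies in `H₁` and sees only the `H₁` part of `J g - K J
g`, which is `g - A g`. -/
theorem inner_apply_sub_nonneg_of_mem [CompleteSpace H] {A : H →L[ℂ] H} (h0 : 0 ≤ hat H₁ A)
    (h1 : hat H₁ A ≤ 1) {g : H} (hg : g - A g ∈ H₁) : 0 ≤ (inner ℂ (A g) (g - A g) : ℂ) := by
  have h := inner_apply_sub_nonneg h0 h1 (J H₁ g)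
  have hq : P₂ H₁ g = P₂ H₁ (A g) := sub_eq_zero.1 (by rw [← map_sub, P₂_apply_eq_zero H₁ hg])
  have hgd := P₁_apply_add_P₂_apply H₁ g
  have hAd := P₁_apply_add_P₂_apply H₁ (A g)
  have hK : A g - P₂ H₁ g = P₁ H₁ (A g) := by rw [hq, sub_eq_iff_eq_add, hAd]
  rw [hat_apply, hK, J, sub_apply, inner_sub_right, inner_sub_right, inner_P₁_P₂] at h
  have hf : g - A g = P₁ H₁ g - P₁ H₁ (A g) := by
    rw [← add_sub_add_right_eq_sub (P₁ H₁ g) (P₁ H₁ (A g)) (P₂ H₁ (A g)), hAd, ← hq, hgd]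
  have hi : (inner ℂ (A g) (g - A g) : ℂ) = inner ℂ (P₁ H₁ (A g)) (P₁ H₁ g - P₁ H₁ (A g)) := by
    rw [hf, ← map_sub]
    nth_rw 1 [← hAd]
    rw [inner_add_left, inner_P₂_P₁, add_zero]
  rw [hi, inner_sub_right]
  simpa using h

/-- Here `P₁ g = P₁ A g`, so `J g - K J g = -P₂ A g` lies in `H₁ᗮ`, where `K J g` has component `-(g
- A g)`; the signs cancel. -/
theorem inner_apply_sub_nonneg_of_mem_orthogonal [CompleteSpace H] {A : H →L[ℂ] H}
    (h0 : 0 ≤ hat H₁ A) (h1 : hat H₁ A ≤ 1) {g : H} (hg : g - A g ∈ H₁ᗮ) :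
    0 ≤ (inner ℂ (A g) (g - A g) : ℂ) := by
  have h := inner_apply_sub_nonneg h0 h1 (J H₁ g)
  have hp : P₁ H₁ g = P₁ H₁ (A g) := sub_eq_zero.1 (by rw [← map_sub, P₁_apply_eq_zero H₁ hg])
  have hgd := P₁_apply_add_P₂_apply H₁ g
  have hAd := P₁_apply_add_P₂_apply H₁ (A g)
  have hf : g - A g = P₂ H₁ g - P₂ H₁ (A g) := by
    rw [← add_sub_add_left_eq_sub (P₂ H₁ g) (P₂ H₁ (A g)) (P₁ H₁ (A g)), hAd, ← hp, hgd]
  have hK : A g - P₂ H₁ g = P₁ H₁ g - (g - A g) := by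
    rw [hf, hp, ← sub_add, sub_add_eq_add_sub, hAd]
  have hK' : J H₁ g - (A g - P₂ H₁ g) = -P₂ H₁ (A g) := by
    rw [hK, hf, J, sub_apply]
    abel
  have hi : (inner ℂ (g - A g) (A g) : ℂ) = inner ℂ (A g - P₂ H₁ g) (-P₂ H₁ (A g)) := by
    rw [hK, inner_neg_right, inner_sub_left (P₁ H₁ g), inner_P₁_P₂, zero_sub, neg_neg, hf,
      ← map_sub]
    nth_rw 2 [← hAd]
    rw [inner_add_right, inner_P₂_P₁, zero_add]
  rw [hat_apply, hK', ← hi] at h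
  rw [← inner_conj_symm]
  exact star_nonneg_iff.2 h

theorem block_isPositive [CompleteSpace H] (K : Submodule ℂ H) [K.HasOrthogonalProjection]
    {L : H →L[ℂ] H} (h : ∀ f ∈ K, 0 ≤ (inner ℂ (L f) f : ℂ)) :
    (K.orthogonalProjectionOnto ∘L L ∘L K.subtypeL).IsPositive := by
  rw [isPositive_iff_complex]
  intro x
  have hx := Complex.nonneg_iff.1 (h x x.2)
  have he : (inner ℂ ((K.orthogonalProjectionOnto ∘L L ∘L K.subtypeL) x) x : ℂ) =
      inner ℂ (L x) (x : H) := by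
    exact Submodule.inner_orthogonalProjectionOnto_eq_of_mem_right x (L x)
  rw [he]
  exact ⟨Complex.ext rfl hx.2, hx.1⟩

end Blocks

end JOperator

/-! ### The main theorem -/

theorem mainTheorem6 {H : Type*} [NormedAddCommGroup H] [InnerProductSpace ℂ H] [CompleteSpace H]
    [TopologicalSpace.SeparableSpace H]
    (H₁ : Submodule ℂ H) [H₁.HasOrthogonalProjection]
    (A L : H →L[ℂ] H)
    (hA : A ∈ JOperator.L12 H₁) (hJ : JOperator.IsJSelfAdjoint H₁ A)
    (h0 : 0 ≤ JOperator.hat H₁ A) (h1 : JOperator.hat H₁ A ≤ 1) (hnorm : ‖A‖ < 1)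
    (hL : L = A * Ring.inverse (1 - A)) :
    IsUnit (1 - A) ∧
    JOperator.IsJSelfAdjoint H₁ L ∧ L ∈ JOperator.L12 H₁ ∧
    (JOperator.block₁₁ H₁ L).IsPositive ∧ (JOperator.block₂₂ H₁ L).IsPositive := by
  have hu := isUnit_one_sub_of_norm_lt_one hnorm
  have hB := Ring.mul_inverse_cancel _ hu
  have hAB : Ring.inverse (1 - A) = 1 + L := by
    rw [sub_mul, one_mul, ← hL] at hB
    exact sub_eq_iff_eq_add.1 hB
  have hL' : L = A + A * L := by
    conv_lhs => rw [hL, hAB, mul_add, mul_one]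
  have hf (f : H) : Ring.inverse (1 - A) f - A (Ring.inverse (1 - A) f) = f := by
    simpa using congrArg (fun T : H →L[ℂ] H => T f) hB
  have hLf (f : H) : L f = A (Ring.inverse (1 - A) f) := by rw [hL, mul_apply_eq_comp]
  refine ⟨hu, hJ.of_mul_one_sub H₁ hB hL, JOperator.mem_L12_of_eq_add_mul H₁ hA hL hL',
    JOperator.block_isPositive H₁ fun f hfm => ?_, JOperator.block_isPositive H₁ᗮ fun f hfm => ?_⟩
  · have h := JOperator.inner_apply_sub_nonneg_of_mem h0 h1 (g := Ring.inverse (1 - A) f)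
      (by rwa [hf])
    rwa [hf, ← hLf] at h
  · have h := JOperator.inner_apply_sub_nonneg_of_mem_orthogonal h0 h1
      (g := Ring.inverse (1 - A) f) (by rwa [hf])
    rwa [hf, ← hLf] at h
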